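/- For every real number $x \in (0,1)$ and every real $\delta > 0$ there is an integer $N$ such that for every integer $n \ge N$ there exist a linear hypergraph $H$ with exactly $n$ vertices (a hypergraph is linear if any two distinct edges share at most one vertex; isolated vertices are allowed) and an integer $r$ with the following properties: 1. $q_{\mathrm{list}}(H) > xn$, where $q_{\mathrm{list}}(H)$ is the list edge chromatic number of $H$, i.e. the list chromatic number of its line graph (the graph whose vertices are the edges of $H$, two distinct ones being adjacent iff they intersect); 2. every edge of $H$ has exactly $r$ vertices, i.e. the minimum and the maximum edge size of $H$ are both equal to $r$; 3. $\sqrt{nx} \le r \le (1+\delta)\sqrt{nx}$. -/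

import Mathlib

universe u

/-- `G` is `k`-choosable: whenever every vertex `v` is given a list `L v` of at least `k` colors
(from an arbitrary set `C` of colors), there is a proper coloring of `G` that gives each vertex a
color of its own list. -/
def SimpleGraph.Choosable {V : Type u} (G : SimpleGraph V) (k : ℕ) : Prop :=
  ∀ (C : Type u) (L : V → Finset C), (∀ v, k ≤ (L v).card) →
    ∃ c : G.Coloring C, ∀ v, c v ∈ L v

/-- The list chromatic number: the least `k` such that `G` is `k`-choosable (`⊤` if there is
none). -/
noncomputable def SimpleGraph.listChromaticNumber {V : Type u} (G : SimpleGraph V) : ℕ∞ :=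
  ⨅ k : {k : ℕ // G.Choosable k}, ((k : ℕ) : ℕ∞)

namespace Hypergraph

variable {V : Type u} (H : Hypergraph V)

/-- Any two distinct edges share at most one vertex. -/
def IsLinear : Prop :=
  ∀ e ∈ H.edgeSet, ∀ f ∈ H.edgeSet, e ≠ f → (e ∩ f).encard ≤ 1

/-- The minimum edge size (`⊤` if there are no edges). -/
noncomputable def minRank : ℕ∞ := ⨅ e ∈ H.edgeSet, e.encard

/-- The maximum edge size (`0` if there are no edges). -/
noncomputable def maxRank : ℕ∞ := ⨆ e ∈ H.edgeSet, e.encard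

/-- The line graph: its vertices are the edges of `H`, and two distinct ones are adjacent iff they
intersect. -/
def lineGraph : SimpleGraph H.edgeSet where
  Adj e f := e ≠ f ∧ ((e : Set V) ∩ (f : Set V)).Nonempty
  symm := ⟨fun _ _ h => ⟨h.1.symm, by simpa only [Set.inter_comm] using h.2⟩⟩
  loopless := ⟨fun _ h => h.1 rfl⟩

/-- The list edge chromatic number: the list chromatic number of the line graph. -/
noncomputable def listEdgeChromaticNumber : ℕ∞ := H.lineGraph.listChromaticNumber

end Hypergraph

/-! Any two lines of a projective plane of order `q` meet, so its line graph is complete on `q ^ 2 +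
q + 1` vertices, which is also its list chromatic number. Such planes exist for prime powers `q`. If
`q` is at least, but close to, `√(nx)`, the plane fits into `n` vertices because `x < 1`, has more
than `xn` lines, and is uniform of rank `q + 1`.

What remains is a prime power in `[y, (1 + ε) y]` for large `y`, proved by a Wiener–Ikehara
argument. The series of `Λ n - 1` extends continuously to `1 ≤ re s`, so its averages against a
Fejér kernel centred at `log n = ℓ` tend to `0` as `ℓ → ∞` (`tendsto_twistedIntegral_atTop`). If no
prime power lay near `exp ℓ`, the `Λ` part would be `O(1 / T)` by Chebyshev's bound, while the `-1`
part would keep the average below a fixed negative number (`twistedIntegral_le_of_gap`). -/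

/-- A complete graph on a finite type has list chromatic number equal to its order. -/
theorem SimpleGraph.listChromaticNumber_eq_card_of_eq_top {V : Type} [Finite V]
    {G : SimpleGraph V} (hG : ∀ v w, v ≠ w → G.Adj v w) :
    G.listChromaticNumber = (Nat.card V : ℕ∞) := by
  classical
  have := Fintype.ofFinite V
  apply le_antisymm
  · refine iInf_le_of_le ⟨Nat.card V, fun C L hL => ?_⟩ le_rfl
    -- Hall's condition: one list alone has at least as many colors as there are vertices.
    have hall : ∀ s : Finset V, s.card ≤ (s.biUnion L).card := by
      intro s
      rcases s.eq_empty_or_nonempty with rfl | ⟨v, hv⟩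
      · simp
      · calc s.card ≤ Nat.card V := by
              rw [Nat.card_eq_fintype_card]; exact s.card_le_univ
          _ ≤ (L v).card := hL v
          _ ≤ _ := Finset.card_le_card (Finset.subset_biUnion_of_mem L hv)
    obtain ⟨c, hc, hcL⟩ := (Finset.all_card_le_biUnion_card_iff_exists_injective L).mp hall
    exact ⟨SimpleGraph.Coloring.mk c fun h => hc.ne h.ne, hcL⟩
  · refine le_iInf fun ⟨k, hk⟩ => ?_
    obtain ⟨c, hc⟩ := hk ℕ (fun _ => Finset.range k) (by simp)
    have hinj : Function.Injective fun v => (⟨c v, Finset.mem_range.mp (hc v)⟩ : Fin k) := by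
      intro v w h
      by_contra hne
      exact c.valid (hG v w hne) (by simpa using h)
    have := Nat.card_le_card_of_injective _ hinj
    simpa using this

/-! ### Projective planes as linear hypergraphs -/

namespace Hypergraph

/-- The hypergraph on `W` whose edges are the images of the lines of a configuration under an
embedding of its points. -/
def ofConfiguration {P L W : Type} [Membership P L] (f : P ↪ W) : Hypergraph W where
  vertexSet := Set.univ
  edgeSet := Set.range fun l : L => f '' {p | p ∈ l}
  subset_vertexSet_of_mem_edgeSet' := fun _ _ => Set.subset_univ _

section ProjectivePlane

open Configuration

variable {P L W : Type} [Membership P L] [ProjectivePlane P L] (f : P ↪ W)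

theorem isLinear_ofConfiguration : (ofConfiguration (L := L) f).IsLinear := by
  rintro _ ⟨l, rfl⟩ _ ⟨m, rfl⟩ hne
  have hlm : l ≠ m := fun h => hne (by rw [h])
  rw [Set.encard_le_one_iff]
  rintro _ _ ⟨⟨a, ha, rfl⟩, a', ha', haa⟩ ⟨⟨b, hb, rfl⟩, b', hb', hbb⟩
  rw [f.injective haa] at ha'
  rw [f.injective hbb] at hb'
  rcases Nondegenerate.eq_or_eq (l₁ := l) (l₂ := m) ha hb ha' hb' with h | h
  · rw [h]
  · exact absurd h hlm

variable [Finite P] [Finite L]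

theorem encard_of_mem_edgeSet_ofConfiguration {e : Set W}
    (he : e ∈ (ofConfiguration (L := L) f).edgeSet) :
    e.encard = (ProjectivePlane.order P L + 1 : ℕ) := by
  obtain ⟨l, rfl⟩ := he
  rw [f.injective.encard_image, ← ProjectivePlane.pointCount_eq (P := P) l,
    ← (Set.toFinite _).cast_ncard_eq]
  rfl

/-- Ensures that passing to edges as sets loses no lines: a line has at least two points, and these
determine it. -/
theorem injective_image_line :
    Function.Injective fun l : L => f '' {p | p ∈ l} := by
  classical
  intro l m h
  have hlm : {p : P | p ∈ l} = {p | p ∈ m} := f.injective.image_injective h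
  have hcard : 2 < pointCount P l := ProjectivePlane.two_lt_pointCount P l
  have : (1 : ℕ) < Set.ncard {p : P | p ∈ l} := lt_trans one_lt_two hcard
  obtain ⟨a, b, ha, hb, hab⟩ := (Set.one_lt_ncard_iff (Set.toFinite _)).mp this
  exact (Nondegenerate.eq_or_eq (l₁ := l) (l₂ := m) ha hb (hlm ▸ ha : a ∈ {p : P | p ∈ m})
    (hlm ▸ hb : b ∈ {p : P | p ∈ m})).resolve_left hab

theorem listEdgeChromaticNumber_ofConfiguration :
    (ofConfiguration (L := L) f).listEdgeChromaticNumber =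
      ((ProjectivePlane.order P L ^ 2 + ProjectivePlane.order P L + 1 : ℕ) : ℕ∞) := by
  have := Fintype.ofFinite L
  have hfin : Finite (ofConfiguration (L := L) f).edgeSet := Set.toFinite (Set.range _)
  rw [listEdgeChromaticNumber, SimpleGraph.listChromaticNumber_eq_card_of_eq_top]
  · congr 1
    rw [← ProjectivePlane.card_lines P L, ← Nat.card_eq_fintype_card]
    exact (Nat.card_congr (Equiv.ofInjective _ (injective_image_line (L := L) f))).symm
  · rintro ⟨_, l, rfl⟩ ⟨_, m, rfl⟩ hne
    have hlm : l ≠ m := fun h => hne (by subst h; rfl)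
    obtain ⟨h₁, h₂⟩ := HasPoints.mkPoint_ax (P := P) hlm
    exact ⟨hne, f (HasPoints.mkPoint hlm), ⟨_, h₁, rfl⟩, ⟨_, h₂, rfl⟩⟩

theorem minRank_ofConfiguration :
    (ofConfiguration (L := L) f).minRank = (ProjectivePlane.order P L + 1 : ℕ) := by
  obtain ⟨-, -, -, l, -⟩ := ProjectivePlane.exists_config (P := P) (L := L)
  apply le_antisymm
  · have hl : f '' {p | p ∈ l} ∈ (ofConfiguration (L := L) f).edgeSet := ⟨l, rfl⟩
    exact (iInf₂_le _ hl).trans (encard_of_mem_edgeSet_ofConfiguration f hl).le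
  · exact le_iInf₂ fun e he => (encard_of_mem_edgeSet_ofConfiguration f he).ge

theorem maxRank_ofConfiguration :
    (ofConfiguration (L := L) f).maxRank = (ProjectivePlane.order P L + 1 : ℕ) := by
  obtain ⟨-, -, -, l, -⟩ := ProjectivePlane.exists_config (P := P) (L := L)
  apply le_antisymm
  · exact iSup₂_le fun e he => (encard_of_mem_edgeSet_ofConfiguration f he).le
  · have hl : f '' {p | p ∈ l} ∈ (ofConfiguration (L := L) f).edgeSet := ⟨l, rfl⟩
    exact (encard_of_mem_edgeSet_ofConfiguration f hl).ge.trans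
      (le_iSup₂ (f := fun e _ => e.encard) _ hl)

end ProjectivePlane

/-- The truncation to `n` vertices of a Desarguesian projective plane of prime power order. -/
theorem exists_of_isPrimePow {q n : ℕ} (hq : IsPrimePow q) (hn : q ^ 2 + q + 1 ≤ n) :
    ∃ H : Hypergraph (Fin n), H.vertexSet = Set.univ ∧ H.IsLinear ∧
      H.listEdgeChromaticNumber = ((q ^ 2 + q + 1 : ℕ) : ℕ∞) ∧
      H.minRank = (q + 1 : ℕ) ∧ H.maxRank = (q + 1 : ℕ) := by
  classical
  obtain ⟨p, k, hp, hk, rfl⟩ := hq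
  have : Fact p.Prime := ⟨hp.nat_prime⟩
  let K := GaloisField p k
  have hK : Nat.card K = p ^ k := GaloisField.card p k hk.ne'
  -- `P` serves as both points and lines, with orthogonality as incidence.
  let P := Projectivization K (Fin 3 → K)
  have : Fintype P := Fintype.ofFinite P
  have hcard : Nat.card P = (p ^ k) ^ 2 + p ^ k + 1 := by
    rw [Projectivization.card_of_finrank K (Fin 3 → K) (n := 3) (by simp), hK]
    simp [Finset.sum_range_succ]
    ring
  have horder : Configuration.ProjectivePlane.order P P = p ^ k := by
    have h := Configuration.ProjectivePlane.card_points P P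
    rw [← Nat.card_eq_fintype_card, hcard] at h
    nlinarith [h]
  have hemb : Nonempty (P ↪ Fin n) := by
    apply Function.Embedding.nonempty_of_card_le
    rw [← Nat.card_eq_fintype_card, hcard, Fintype.card_fin]
    exact hn
  obtain ⟨f⟩ := hemb
  refine ⟨ofConfiguration (L := P) f, rfl, isLinear_ofConfiguration f, ?_, ?_, ?_⟩
  · rw [listEdgeChromaticNumber_ofConfiguration, horder]
  · rw [minRank_ofConfiguration, horder]
  · rw [maxRank_ofConfiguration, horder]

end Hypergraph

/-! ### The Dirichlet series of `Λ n - 1` up to the line `re s = 1` -/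

open Complex Filter Topology MeasureTheory

open ArithmeticFunction in
/-- The Dirichlet series with coefficients `Λ n - 1` extends continuously to the closed half plane
`1 ≤ re s`. -/
theorem exists_continuousOn_eq_LSeries_vonMangoldt_sub_one :
    ∃ G : ℂ → ℂ, ContinuousOn G {s | 1 ≤ s.re} ∧
      ∀ s : ℂ, 1 < s.re → LSeriesHasSum (fun n => (vonMangoldt n : ℂ) - 1) s (G s) := by
  have hd := DirichletCharacter.differentiable_LFunctionTrivChar₁ 1
  -- `-ζ'/ζ` and `ζ` both have principal part `1 / (s - 1)`; each term here is one of them with this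
  -- pole removed.
  refine ⟨fun s => vonMangoldt.LFunctionResidueClassAux (1 : ZMod 1) s -
    dslope (DirichletCharacter.LFunctionTrivChar₁ 1) 1 s, ?_, fun s hs => ?_⟩
  · refine (vonMangoldt.continuousOn_LFunctionResidueClassAux 1).sub
      (Continuous.continuousOn ?_)
    rw [← continuousOn_univ, continuousOn_dslope Filter.univ_mem]
    exact ⟨hd.continuous.continuousOn, hd 1⟩
  · have hs1 : s ≠ 1 := fun h => by simp [h] at hs
    have hs2 : s - 1 ≠ 0 := sub_ne_zero.mpr hs1
    have hres : vonMangoldt.residueClass (1 : ZMod 1) = vonMangoldt := by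
      funext n
      simp [vonMangoldt.residueClass, Set.indicator, eq_iff_true_of_subsingleton]
    have h1 := vonMangoldt.eqOn_LFunctionResidueClassAux (isUnit_one (M := ZMod 1)) hs
    have h2 : dslope (DirichletCharacter.LFunctionTrivChar₁ 1) 1 s =
        riemannZeta s - 1 / (s - 1) := by
      rw [dslope_of_ne _ hs1, slope_def_field]
      simp only [DirichletCharacter.LFunctionTrivChar₁, Function.update_of_ne hs1,
        Function.update_self]
      simp [DirichletCharacter.LFunctionTrivChar]
      field_simp
    have h3 : vonMangoldt.LFunctionResidueClassAux (1 : ZMod 1) s -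
        dslope (DirichletCharacter.LFunctionTrivChar₁ 1) 1 s =
        LSeries (fun n => (vonMangoldt n : ℂ)) s - riemannZeta s := by
      rw [h1, h2, hres]; simp
    show LSeriesHasSum _ s (_ - _)
    rw [h3]
    exact (LSeriesSummable_vonMangoldt hs).LSeriesHasSum.sub (LSeriesHasSum_one hs)

/-! ### Fejér kernel and smoothed sums -/

/-- The cosine transform of the triangle function with support `[-T, T]`. -/
noncomputable def fejerKernel (T u : ℝ) : ℝ := ∫ t in (0 : ℝ)..T, (1 - t / T) * Real.cos (t * u)

theorem fejerKernel_eq {T u : ℝ} (hT : 0 < T) (hu : u ≠ 0) :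
    fejerKernel T u = (1 - Real.cos (T * u)) / (T * u ^ 2) := by
  have hderiv : ∀ t ∈ Set.uIcc 0 T, HasDerivAt
      (fun t : ℝ => (1 - t / T) * (Real.sin (t * u) / u) - Real.cos (t * u) / (T * u ^ 2))
      ((1 - t / T) * Real.cos (t * u)) t := by
    intro t _
    have h0 : HasDerivAt (fun t : ℝ => t * u) u t := by
      simpa using (hasDerivAt_id t).mul_const u
    have h1 : HasDerivAt (fun t : ℝ => 1 - t / T) (-(1 / T)) t := by
      simpa using ((hasDerivAt_id t).div_const T).const_sub 1
    have h2 := ((Real.hasDerivAt_sin _).comp t h0).div_const u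
    have h3 := ((Real.hasDerivAt_cos _).comp t h0).div_const (T * u ^ 2)
    refine ((h1.mul h2).sub h3).congr_deriv ?_
    simp only [Function.comp]
    field_simp
    ring
  rw [fejerKernel, intervalIntegral.integral_eq_sub_of_hasDerivAt hderiv
    (Continuous.intervalIntegrable (by fun_prop) _ _)]
  simp
  field_simp
  ring

theorem fejerKernel_nonneg {T : ℝ} (hT : 0 < T) (u : ℝ) : 0 ≤ fejerKernel T u := by
  rcases eq_or_ne u 0 with rfl | hu
  · refine intervalIntegral.integral_nonneg hT.le fun t ht => ?_
    have : t / T ≤ 1 := (div_le_one hT).mpr ht.2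
    simpa using this
  · rw [fejerKernel_eq hT hu]
    have := Real.cos_le_one (T * u)
    exact div_nonneg (by linarith) (by positivity)

theorem fejerKernel_le {T u : ℝ} (hT : 0 < T) (hu : u ≠ 0) :
    fejerKernel T u ≤ 2 / (T * u ^ 2) := by
  rw [fejerKernel_eq hT hu]
  have := Real.neg_one_le_cos (T * u)
  gcongr
  linarith

/-- Follows from `cos v ≤ 1 - (2 / π ^ 2) v ^ 2` for `|v| ≤ π`; the constant `1 / 8` comes from `π ≤
4`. -/
theorem le_fejerKernel {T u : ℝ} (hT : 0 < T) (hu : u ≠ 0) (hTu : |T * u| ≤ 1) :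
    T / 8 ≤ fejerKernel T u := by
  have hpi := Real.pi_le_four
  have hpi3 := Real.pi_gt_three
  rw [fejerKernel_eq hT hu, le_div_iff₀ (by positivity)]
  have h := Real.cos_le_one_sub_mul_cos_sq (hTu.trans (by linarith))
  have h8 : 1 / 8 ≤ 2 / Real.pi ^ 2 := by
    rw [div_le_div_iff₀ (by norm_num) (by positivity)]
    nlinarith
  have := mul_le_mul_of_nonneg_right h8 (sq_nonneg (T * u))
  nlinarith

/-- Real part of a term of a Dirichlet series with real coefficients, twisted by `exp (i t ℓ)`. -/
theorem re_term_mul_exp (a : ℕ → ℝ) {σ : ℝ} (hσ : σ ≠ 0) (t ℓ : ℝ) (n : ℕ) :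
    (LSeries.term (fun n => (a n : ℂ)) (σ + t * I) n * cexp (t * ℓ * I)).re =
      a n * (n : ℝ) ^ (-σ) * Real.cos (t * (ℓ - Real.log n)) := by
  rcases eq_or_ne n 0 with rfl | hn
  · simp [Real.zero_rpow (neg_ne_zero.mpr hσ)]
  · have hn' : (0 : ℝ) < n := by positivity
    rw [LSeries.term_of_ne_zero hn, Real.rpow_def_of_pos hn', div_eq_mul_inv, ← cpow_neg,
      cpow_def_of_ne_zero (by exact_mod_cast hn), mul_assoc, ← Complex.exp_add,
      ← Complex.natCast_log]
    have : (Real.log n : ℂ) * -(σ + t * I) + t * ℓ * I =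
        (Real.log n * -σ : ℝ) + (t * (ℓ - Real.log n) : ℝ) * I := by
      push_cast; ring
    rw [this, Complex.exp_add, ← ofReal_exp, Complex.re_ofReal_mul, Complex.re_ofReal_mul,
      Complex.exp_ofReal_mul_I_re, mul_assoc]

/-- The cosine transform of a twisted function on the line `re s = σ`. -/
noncomputable def twistedIntegral (G : ℂ → ℂ) (T σ ℓ : ℝ) : ℝ :=
  ∫ t in (0 : ℝ)..T, (1 - t / T) * (G (σ + t * I) * cexp (t * ℓ * I)).re

theorem hasSum_mul_fejerKernel {a : ℕ → ℝ} {G : ℂ → ℂ}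
    (hG : ∀ s : ℂ, 1 < s.re → LSeriesHasSum (fun n => (a n : ℂ)) s (G s))
    {T σ : ℝ} (hT : 0 < T) (hσ : 1 < σ) (ℓ : ℝ) :
    HasSum (fun n : ℕ => a n * (n : ℝ) ^ (-σ) * fejerKernel T (ℓ - Real.log n))
      (twistedIntegral G T σ ℓ) := by
  have hσ0 : σ ≠ 0 := by linarith
  have hsum : Summable fun n => ‖LSeries.term (fun n => (a n : ℂ)) σ n‖ :=
    (hG σ (by simpa using hσ)).LSeriesSummable.norm
  have key := intervalIntegral.hasSum_integral_of_dominated_convergence (μ := volume)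
    (a := 0) (b := T)
    (F := fun (n : ℕ) (t : ℝ) =>
      (1 - t / T) * (a n * (n : ℝ) ^ (-σ) * Real.cos (t * (ℓ - Real.log n))))
    (f := fun t => (1 - t / T) * (G (σ + t * I) * cexp (t * ℓ * I)).re)
    (fun n _ => ‖LSeries.term (fun n => (a n : ℂ)) σ n‖)
    (fun n => (Continuous.aestronglyMeasurable (by fun_prop)))
    (fun n => Eventually.of_forall fun t ht => ?_)
    (Eventually.of_forall fun t _ => hsum)
    intervalIntegrable_const
    (Eventually.of_forall fun t _ => ?_)
  · refine (congrArg (HasSum · _) (funext fun n => ?_)).mpr key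
    rw [fejerKernel, ← intervalIntegral.integral_const_mul]
    refine intervalIntegral.integral_congr fun t _ => ?_
    ring
  · rw [Set.uIoc_of_le hT.le] at ht
    have h1 : t / T ≤ 1 := (div_le_one hT).mpr ht.2
    have h2 : 0 ≤ t / T := div_nonneg ht.1.le hT.le
    rw [← re_term_mul_exp a hσ0, norm_mul]
    have h3 : ‖1 - t / T‖ ≤ 1 := by rw [Real.norm_eq_abs, abs_le]; constructor <;> linarith
    have h4 : ‖cexp (t * ℓ * I)‖ = 1 := by exact_mod_cast norm_exp_ofReal_mul_I (t * ℓ)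
    refine (mul_le_of_le_one_left (norm_nonneg _) h3).trans ?_
    refine (abs_re_le_norm _).trans ?_
    rw [norm_mul, h4, mul_one]
    exact LSeries.norm_term_le_of_re_le_re _ (by simp) n
  · refine HasSum.mul_left _ ?_
    simp_rw [← re_term_mul_exp a hσ0]
    exact Complex.hasSum_re ((hG (σ + t * I) (by simpa using hσ)).mul_right _)

theorem tendsto_twistedIntegral_one {G : ℂ → ℂ} (hG : ContinuousOn G {s | 1 ≤ s.re})
    (T ℓ : ℝ) :
    Tendsto (fun σ => twistedIntegral G T σ ℓ) (𝓝[>] 1) (𝓝 (twistedIntegral G T 1 ℓ)) := by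
  -- Replacing `σ` by `max σ 1` keeps the argument of `G` in the closed half plane.
  have hc : Continuous fun p : ℝ × ℝ => G ((max p.1 1 : ℝ) + p.2 * I) := by
    refine hG.comp_continuous (by fun_prop) fun p => ?_
    simp
  have hint : Continuous fun σ => twistedIntegral G T (max σ 1) ℓ := by
    unfold twistedIntegral
    refine intervalIntegral.continuous_parametric_intervalIntegral_of_continuous' ?_ _ _
    refine Continuous.mul (by fun_prop) (Complex.continuous_re.comp (Continuous.mul ?_ ?_))
    · exact hc
    · fun_prop
  have h := (hint.tendsto 1).mono_left (nhdsWithin_le_nhds (s := Set.Ioi 1))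
  rw [max_self] at h
  refine h.congr' ?_
  filter_upwards [self_mem_nhdsWithin] with σ hσ
  rw [max_eq_left (le_of_lt hσ)]

/-- The Riemann–Lebesgue lemma, applied to `(1 - t / T) G(1 + it)` cut off to `(0, T]`. -/
theorem tendsto_twistedIntegral_atTop {G : ℂ → ℂ} (hG : ContinuousOn G {s | 1 ≤ s.re})
    {T : ℝ} (hT : 0 < T) :
    Tendsto (fun ℓ => twistedIntegral G T 1 ℓ) atTop (𝓝 0) := by
  have hc : Continuous fun t : ℝ => ((1 - t / T : ℝ) : ℂ) * G ((1 : ℝ) + t * I) := by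
    refine Continuous.mul (by fun_prop) (hG.comp_continuous (by fun_prop) fun p => ?_)
    simp
  have hRL := Real.tendsto_integral_exp_smul_cocompact
    ((Set.Ioc 0 T).indicator fun t : ℝ => ((1 - t / T : ℝ) : ℂ) * G ((1 : ℝ) + t * I))
  have hℓ : Tendsto (fun ℓ : ℝ => -(ℓ / (2 * Real.pi))) atTop (cocompact ℝ) := by
    rw [cocompact_eq_atBot_atTop]
    refine Tendsto.mono_right ?_ le_sup_left
    exact tendsto_neg_atTop_atBot.comp (tendsto_id.atTop_div_const (by positivity))
  have h := (Complex.continuous_re.tendsto _).comp (hRL.comp hℓ)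
  rw [Complex.zero_re] at h
  refine h.congr fun ℓ => ?_
  have hpt : ∀ t : ℝ, Real.fourierChar (-(t * -(ℓ / (2 * Real.pi)))) •
      (Set.Ioc 0 T).indicator (fun t : ℝ => ((1 - t / T : ℝ) : ℂ) * G ((1 : ℝ) + t * I)) t =
      (Set.Ioc 0 T).indicator (fun t : ℝ => ((1 - t / T : ℝ) : ℂ) *
        (G ((1 : ℝ) + t * I) * cexp (t * ℓ * I))) t := by
    intro t
    by_cases ht : t ∈ Set.Ioc 0 T
    · rw [Set.indicator_of_mem ht, Set.indicator_of_mem ht, Circle.smul_def, Real.fourierChar_apply,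
        smul_eq_mul]
      have : ((2 * Real.pi * -(t * -(ℓ / (2 * Real.pi))) : ℝ) : ℂ) * I = t * ℓ * I := by
        have : 2 * Real.pi * -(t * -(ℓ / (2 * Real.pi))) = t * ℓ := by
          field_simp
        rw [this]; push_cast; ring
      rw [this]; ring
    · simp [Set.indicator_of_notMem ht]
  simp only [Function.comp, hpt]
  rw [integral_indicator measurableSet_Ioc, twistedIntegral, intervalIntegral.integral_of_le hT.le]
  rw [← RCLike.re_eq_complex_re, ← integral_re]
  · refine integral_congr_ae (Eventually.of_forall fun t => ?_)
    simp
  · have : Continuous fun t : ℝ => ((1 - t / T : ℝ) : ℂ) *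
        (G ((1 : ℝ) + t * I) * cexp (t * ℓ * I)) := by
      simp_rw [← mul_assoc]
      exact hc.mul (by fun_prop)
    exact this.integrableOn_Ioc

/-! ### Chebyshev and harmonic sum bounds -/

open ArithmeticFunction in
/-- Uniform bound for Poisson-type averages of `Λ n / n`. -/
theorem exists_sum_vonMangoldt_div_le :
    ∃ C : ℝ, 0 < C ∧ ∀ (ℓ : ℝ) (s : Finset ℕ),
      ∑ n ∈ s, vonMangoldt n * (n : ℝ)⁻¹ * (1 + (ℓ - Real.log n) ^ 2)⁻¹ ≤ C := by
  have hsum : Summable fun k : ℤ => (1 + (k : ℝ) ^ 2)⁻¹ := by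
    refine Summable.of_norm_bounded_eventually
      (Real.summable_one_div_int_pow.mpr (one_lt_two : 1 < 2)) ?_
    rw [Filter.eventually_cofinite]
    refine (Set.finite_singleton (0 : ℤ)).subset fun k hk => ?_
    by_contra hk0
    have hk0 : (k : ℝ) ≠ 0 := by exact_mod_cast hk0
    apply hk
    rw [Real.norm_of_nonneg (by positivity), one_div]
    gcongr
    linarith
  set A := Real.log 4 + 4
  have hA : 0 < A := by have := Real.log_nonneg (show (1 : ℝ) ≤ 4 by norm_num); positivity
  set S := ∑' k : ℤ, (1 + (k : ℝ) ^ 2)⁻¹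
  have hS : 0 ≤ S := tsum_nonneg fun k => by positivity
  refine ⟨A * Real.exp 1 * 3 * S + 1, by positivity, fun ℓ s => ?_⟩
  -- On a window `k ≤ log n - ℓ < k + 1`, Chebyshev's bound on `ψ` controls the sum of `Λ n / n`.
  -- With `u = log n - ℓ`, the factor `3` comes from `1 + k ^ 2 ≤ 3 (1 + u ^ 2)`, valid as `|u - k|
  -- ≤ 1`.
  have hfib : ∀ k : ℤ, ∑ n ∈ s.filter (fun n : ℕ => ⌊Real.log n - ℓ⌋ = k),
      vonMangoldt n * (n : ℝ)⁻¹ * (1 + (ℓ - Real.log n) ^ 2)⁻¹ ≤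
      A * Real.exp 1 * 3 * (1 + (k : ℝ) ^ 2)⁻¹ := by
    intro k
    have hterm : ∀ n ∈ s.filter (fun n : ℕ => ⌊Real.log n - ℓ⌋ = k),
        vonMangoldt n * (n : ℝ)⁻¹ * (1 + (ℓ - Real.log n) ^ 2)⁻¹ ≤
        vonMangoldt n * (Real.exp (-(ℓ + k)) * (3 * (1 + (k : ℝ) ^ 2)⁻¹)) := by
      intro n hn
      obtain ⟨h1, h2⟩ := Int.floor_eq_iff.mp (Finset.mem_filter.mp hn).2
      rcases eq_or_ne n 0 with rfl | hn0
      · simp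
      have hn' : (0 : ℝ) < n := by positivity
      rw [mul_assoc]
      refine mul_le_mul_of_nonneg_left ?_ vonMangoldt_nonneg
      refine mul_le_mul ?_ ?_ (by positivity) (by positivity)
      · rw [Real.exp_neg]
        gcongr
        rw [← Real.le_log_iff_exp_le hn']
        linarith
      · rw [← div_eq_mul_inv, inv_eq_one_div, div_le_div_iff₀ (by positivity) (by positivity)]
        nlinarith [sq_nonneg (2 * (Real.log n - ℓ) - k), sq_nonneg (Real.log n - ℓ - k),
          sq_nonneg (ℓ - Real.log n)]
    refine (Finset.sum_le_sum hterm).trans ?_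
    rw [← Finset.sum_mul]
    have hpsi : ∑ n ∈ s.filter (fun n : ℕ => ⌊Real.log n - ℓ⌋ = k), vonMangoldt n ≤
        A * Real.exp (ℓ + k + 1) := by
      refine le_trans ?_ (Chebyshev.psi_le_const_mul_self (Real.exp_pos _).le)
      -- Discards `n = 0`, which the convention `log 0 = 0` may place in the window.
      rw [← Finset.sum_filter_ne_zero]
      refine Finset.sum_le_sum_of_subset_of_nonneg (fun n hn => ?_)
        fun _ _ _ => vonMangoldt_nonneg
      obtain ⟨hn, hne⟩ := Finset.mem_filter.mp hn
      have hn0 : n ≠ 0 := fun h => hne (by simp [h])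
      have h2 := (Int.floor_eq_iff.mp (Finset.mem_filter.mp hn).2).2
      rw [Finset.mem_Ioc]
      refine ⟨Nat.pos_of_ne_zero hn0, Nat.le_floor ?_⟩
      rw [← Real.log_le_iff_le_exp (by positivity)]
      linarith
    calc _ ≤ A * Real.exp (ℓ + k + 1) * (Real.exp (-(ℓ + k)) * (3 * (1 + (k : ℝ) ^ 2)⁻¹)) := by
          gcongr
      _ = A * (Real.exp (ℓ + k + 1) * Real.exp (-(ℓ + k))) * 3 * (1 + (k : ℝ) ^ 2)⁻¹ := by ring
      _ = _ := by rw [← Real.exp_add]; congr 4; ring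
  rw [← Finset.sum_fiberwise_of_maps_to (t := s.image fun n : ℕ => ⌊Real.log n - ℓ⌋)
    (fun n hn => Finset.mem_image_of_mem _ hn)]
  calc _ ≤ ∑ k ∈ s.image fun n : ℕ => ⌊Real.log n - ℓ⌋,
        A * Real.exp 1 * 3 * (1 + (k : ℝ) ^ 2)⁻¹ := Finset.sum_le_sum fun k _ => hfib k
    _ = A * Real.exp 1 * 3 * ∑ k ∈ s.image fun n : ℕ => ⌊Real.log n - ℓ⌋,
        (1 + (k : ℝ) ^ 2)⁻¹ := by rw [Finset.mul_sum]
    _ ≤ A * Real.exp 1 * 3 * S := by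
        gcongr
        exact hsum.sum_le_tsum _ fun k _ => by positivity
    _ ≤ _ := by linarith

/-- The harmonic sum over `(exp ℓ, exp (ℓ + 1 / T)]`. -/
theorem le_sum_inv_Ioc_floor_exp {T : ℝ} (hT : 1 ≤ T) (ℓ : ℝ) :
    1 / (2 * T) - Real.exp (-ℓ) ≤
      ∑ n ∈ Finset.Ioc ⌊Real.exp ℓ⌋₊ ⌊Real.exp (ℓ + 1 / T)⌋₊, (n : ℝ)⁻¹ := by
  have hT0 : 0 < T := by linarith
  have hle : Real.exp ℓ ≤ Real.exp (ℓ + 1 / T) :=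
    Real.exp_le_exp.mpr (by have : 0 < 1 / T := by positivity
                            linarith)
  have hterm : ∀ n ∈ Finset.Ioc ⌊Real.exp ℓ⌋₊ ⌊Real.exp (ℓ + 1 / T)⌋₊,
      Real.exp (-(ℓ + 1 / T)) ≤ (n : ℝ)⁻¹ := by
    intro n hn
    obtain ⟨h1, h2⟩ := Finset.mem_Ioc.mp hn
    have h0 : (0 : ℝ) < n := by exact_mod_cast (Nat.zero_le _).trans_lt h1
    rw [Real.exp_neg]
    gcongr
    exact (Nat.le_floor_iff (Real.exp_pos _).le).mp h2
  refine le_trans ?_ (Finset.card_nsmul_le_sum _ _ _ hterm)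
  rw [Nat.card_Ioc, nsmul_eq_mul, Nat.cast_sub (Nat.floor_mono hle)]
  have h1 := Nat.lt_floor_add_one (Real.exp (ℓ + 1 / T))
  have h2 := Nat.floor_le (Real.exp_pos ℓ).le
  have h3 : Real.exp (-(1 / T)) ≤ 1 - 1 / (2 * T) := by
    have h4 := Real.add_one_le_exp (1 / T)
    have h5 : Real.exp (-(1 / T)) * Real.exp (1 / T) = 1 := by
      rw [← Real.exp_add]; simp
    have h6 : 1 ≤ (1 - 1 / (2 * T)) * (1 / T + 1) := by
      have h7 : (1 - 1 / (2 * T)) * (1 / T + 1) = 1 + (T - 1) / (2 * T ^ 2) := by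
        field_simp
        ring
      rw [h7]
      have : 0 ≤ (T - 1) / (2 * T ^ 2) := div_nonneg (by linarith) (by positivity)
      linarith
    have h8 : 0 ≤ 1 - 1 / (2 * T) := by
      rw [sub_nonneg, div_le_one (by positivity)]; linarith
    rw [← mul_le_mul_iff_left₀ (Real.exp_pos (1 / T)), h5]
    exact h6.trans (mul_le_mul_of_nonneg_left h4 h8)
  have h4 : Real.exp (-(ℓ + 1 / T)) ≤ Real.exp (-ℓ) :=
    Real.exp_le_exp.mpr (by have : 0 < 1 / T := by positivity
                            linarith)
  calc 1 / (2 * T) - Real.exp (-ℓ) ≤ 1 - Real.exp (-(1 / T)) - Real.exp (-(ℓ + 1 / T)) := by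
        linarith
    _ = (Real.exp (ℓ + 1 / T) - 1 - Real.exp ℓ) * Real.exp (-(ℓ + 1 / T)) := by
        rw [sub_mul, sub_mul, ← Real.exp_add, ← Real.exp_add]
        rw [show ℓ + 1 / T + -(ℓ + 1 / T) = 0 by ring, show ℓ + -(ℓ + 1 / T) = -(1 / T) by ring,
          Real.exp_zero]
        ring
    _ ≤ _ := by
        gcongr
        linarith

/-! ### Prime powers in short intervals -/

open ArithmeticFunction

/-- The first term bounds the `Λ` part, where only the kernel's tail `|u| ≥ η` is seen. The rest is
the `-1` part, restricted to `ℓ < log n ≤ ℓ + 1 / T`: there the kernel is at least `T / 8` and the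
harmonic mass about `1 / (2 T)`, whence `1 / 16`. All estimates are made for `σ > 1`, then `σ → 1`.
-/
theorem twistedIntegral_le_of_gap {G : ℂ → ℂ} (hGc : ContinuousOn G {s | 1 ≤ s.re})
    (hG : ∀ s : ℂ, 1 < s.re → LSeriesHasSum (fun n => (vonMangoldt n : ℂ) - 1) s (G s))
    {C : ℝ} (hC : ∀ (ℓ : ℝ) (s : Finset ℕ),
      ∑ n ∈ s, vonMangoldt n * (n : ℝ)⁻¹ * (1 + (ℓ - Real.log n) ^ 2)⁻¹ ≤ C)
    {η T ℓ : ℝ} (hη : 0 < η) (hT : 1 ≤ T)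
    (hgap : ∀ n : ℕ, vonMangoldt n ≠ 0 → η ≤ |ℓ - Real.log n|) :
    twistedIntegral G T 1 ℓ ≤
      2 * (1 + 1 / η ^ 2) * C / T - 1 / 16 + T / 8 * Real.exp (-ℓ) := by
  have hT0 : 0 < T := by linarith
  set S := Finset.Ioc ⌊Real.exp ℓ⌋₊ ⌊Real.exp (ℓ + 1 / T)⌋₊ with hSdef
  have hSpos : ∀ n ∈ S, 0 < n := fun n hn =>
    (Nat.zero_le _).trans_lt (Finset.mem_Ioc.mp hn).1
  have hK : ∀ n ∈ S, T / 8 ≤ fejerKernel T (ℓ - Real.log n) := by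
    intro n hn
    have hn0 : (0 : ℝ) < n := by exact_mod_cast hSpos n hn
    obtain ⟨h1, h2⟩ := Finset.mem_Ioc.mp hn
    have h3 : ℓ < Real.log n := (Real.lt_log_iff_exp_lt hn0).mpr (Nat.lt_of_floor_lt h1)
    have h4 : Real.log n ≤ ℓ + 1 / T :=
      (Real.log_le_iff_le_exp hn0).mpr ((Nat.le_floor_iff (Real.exp_pos _).le).mp h2)
    refine le_fejerKernel hT0 (by linarith) ?_
    rw [abs_mul, abs_of_pos hT0, abs_of_neg (by linarith), ← le_div_iff₀' hT0]
    linarith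
  have hupper : ∀ (σ : ℝ), 1 < σ → ∀ n : ℕ,
      vonMangoldt n * (n : ℝ) ^ (-σ) * fejerKernel T (ℓ - Real.log n) ≤
      2 * (1 + 1 / η ^ 2) / T *
        (vonMangoldt n * (n : ℝ)⁻¹ * (1 + (ℓ - Real.log n) ^ 2)⁻¹) := by
    intro σ hσ n
    rcases eq_or_ne (vonMangoldt n) 0 with h | h
    · simp [h]
    have hn0 : n ≠ 0 := fun h' => h (by simp [h'])
    have hn1 : (1 : ℝ) ≤ n := by exact_mod_cast Nat.one_le_iff_ne_zero.mpr hn0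
    have hu := hgap n h
    set u := ℓ - Real.log n
    have hu2 : η ^ 2 ≤ u ^ 2 := by
      rw [← sq_abs u]; gcongr
    have hu0 : u ≠ 0 := fun h0 => by rw [h0, abs_zero] at hu; linarith
    have hpow : (n : ℝ) ^ (-σ) ≤ (n : ℝ)⁻¹ := by
      rw [← Real.rpow_neg_one]
      exact Real.rpow_le_rpow_of_exponent_le hn1 (by linarith)
    have hker : fejerKernel T u ≤ 2 * (1 + 1 / η ^ 2) / T * (1 + u ^ 2)⁻¹ := by
      refine (fejerKernel_le hT0 hu0).trans ?_
      have hu3 : 0 < u ^ 2 := by positivity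
      have h1 : 1 + u ^ 2 ≤ (1 + 1 / η ^ 2) * u ^ 2 := by
        have : 1 ≤ 1 / η ^ 2 * u ^ 2 := by
          rw [one_div, ← div_eq_inv_mul]
          exact (one_le_div (by positivity)).mpr hu2
        linarith
      rw [← div_eq_mul_inv, div_div, div_le_div_iff₀ (by positivity) (by positivity)]
      calc 2 * (T * (1 + u ^ 2)) ≤ 2 * (T * ((1 + 1 / η ^ 2) * u ^ 2)) := by gcongr
        _ = _ := by ring
    calc _ ≤ vonMangoldt n * (n : ℝ)⁻¹ * (2 * (1 + 1 / η ^ 2) / T * (1 + u ^ 2)⁻¹) := by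
          have := vonMangoldt_nonneg (n := n)
          gcongr
          exact fejerKernel_nonneg hT0 _
      _ = _ := by ring
  have hσ : ∀ σ : ℝ, 1 < σ → twistedIntegral G T σ ℓ ≤
      2 * (1 + 1 / η ^ 2) / T * C - T / 8 * ∑ n ∈ S, (n : ℝ) ^ (-σ) := by
    intro σ hσ
    have hs := hasSum_mul_fejerKernel (a := fun n => vonMangoldt n - 1) (G := G)
      (fun s hs => by simpa using hG s hs) hT0 hσ ℓ
    refine le_of_tendsto hs ?_
    filter_upwards [eventually_ge_atTop S] with s hSs
    simp only [sub_mul, one_mul, Finset.sum_sub_distrib]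
    refine sub_le_sub ?_ ?_
    · refine (Finset.sum_le_sum fun n _ => hupper σ hσ n).trans ?_
      rw [← Finset.mul_sum]
      gcongr
      exact hC ℓ s
    · rw [Finset.mul_sum]
      refine le_trans (Finset.sum_le_sum fun n hn => ?_)
        (Finset.sum_le_sum_of_subset_of_nonneg hSs fun n _ _ =>
          mul_nonneg (Real.rpow_nonneg (Nat.cast_nonneg n) _) (fejerKernel_nonneg hT0 _))
      rw [mul_comm]
      gcongr
      exact hK n hn
  have hlim : Tendsto (fun σ : ℝ => 2 * (1 + 1 / η ^ 2) / T * C -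
      T / 8 * ∑ n ∈ S, (n : ℝ) ^ (-σ)) (𝓝[>] 1) (𝓝 (2 * (1 + 1 / η ^ 2) / T * C -
      T / 8 * ∑ n ∈ S, (n : ℝ) ^ (-1 : ℝ))) := by
    refine tendsto_const_nhds.sub (Tendsto.const_mul _ (tendsto_finsetSum _ fun n hn => ?_))
    have hn0 : (n : ℝ) ≠ 0 := by exact_mod_cast (hSpos n hn).ne'
    have hcont : Continuous fun σ : ℝ => (n : ℝ) ^ (-σ) :=
      continuous_const.rpow continuous_neg fun _ => Or.inl hn0
    exact (hcont.tendsto 1).mono_left nhdsWithin_le_nhds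
  have h1 := le_of_tendsto_of_tendsto (tendsto_twistedIntegral_one hGc T ℓ) hlim
    (by filter_upwards [self_mem_nhdsWithin] with σ h using hσ σ h)
  simp_rw [Real.rpow_neg_one] at h1
  have h2 := mul_le_mul_of_nonneg_left (le_sum_inv_Ioc_floor_exp hT ℓ)
    (show 0 ≤ T / 8 by positivity)
  have h3 : T / 8 * (1 / (2 * T) - Real.exp (-ℓ)) = 1 / 16 - T / 8 * Real.exp (-ℓ) := by
    field_simp
    ring
  have h4 : 2 * (1 + 1 / η ^ 2) / T * C = 2 * (1 + 1 / η ^ 2) * C / T := by ring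
  linarith

/-- Every interval `[y, (1 + ε) y]` with `y` large contains a prime power. -/
theorem eventually_exists_isPrimePow_mem_Icc {ε : ℝ} (hε : 0 < ε) :
    ∀ᶠ y : ℝ in atTop, ∃ q : ℕ, IsPrimePow q ∧ y ≤ q ∧ q ≤ (1 + ε) * y := by
  obtain ⟨G, hGc, hG⟩ := exists_continuousOn_eq_LSeries_vonMangoldt_sub_one
  obtain ⟨C, hC0, hC⟩ := exists_sum_vonMangoldt_div_le
  have hlog : 0 < Real.log (1 + ε) := Real.log_pos (by linarith)
  -- In the logarithmic scale, `log y + η` is the midpoint of `[y, (1 + ε) y]` and `η` its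
  -- half-length.
  set η := Real.log (1 + ε) / 2 with hηdef
  have hη : 0 < η := by positivity
  set D := 2 * (1 + 1 / η ^ 2) * C
  -- Then the upper bound is below `1 / 32 - 1 / 16 + 1 / 64 = -1 / 64`, against the lower bound in
  -- `hev`.
  set T := max 1 (32 * D)
  have hT : 1 ≤ T := le_max_left _ _
  have hDT : D / T ≤ 1 / 32 := by
    rw [div_le_iff₀ (by linarith)]
    have : 32 * D ≤ T := le_max_right _ _
    linarith
  have hexp : Tendsto (fun ℓ : ℝ => T / 8 * Real.exp (-ℓ)) atTop (𝓝 0) := by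
    simpa using (Real.tendsto_exp_neg_atTop_nhds_zero).const_mul (T / 8)
  have hev : ∀ᶠ ℓ : ℝ in atTop, -(1 / 64) < twistedIntegral G T 1 ℓ ∧
      T / 8 * Real.exp (-ℓ) < 1 / 64 :=
    ((tendsto_twistedIntegral_atTop hGc (by linarith)).eventually_const_lt (by norm_num)).and
      (hexp.eventually_lt_const (by norm_num))
  have hℓ : Tendsto (fun y : ℝ => Real.log y + η) atTop atTop :=
    tendsto_atTop_add_const_right _ _ Real.tendsto_log_atTop
  filter_upwards [hℓ.eventually hev, eventually_gt_atTop 0] with y ⟨hy1, hy2⟩ hy0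
  by_contra! hcon
  have hgap : ∀ n : ℕ, vonMangoldt n ≠ 0 → η ≤ |Real.log y + η - Real.log n| := by
    intro n hn
    have hpp := vonMangoldt_ne_zero_iff.mp hn
    have hn0 : (0 : ℝ) < n := by exact_mod_cast hpp.pos
    rcases lt_or_ge (n : ℝ) y with h | h
    · have := Real.log_lt_log hn0 h
      rw [abs_of_pos (by linarith)]
      linarith
    · have := Real.log_lt_log (by positivity) (hcon n hpp h)
      rw [Real.log_mul (by linarith) hy0.ne'] at this
      rw [abs_of_neg (by linarith)]
      linarith
  have := twistedIntegral_le_of_gap hGc hG hC hη hT hgap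
  linarith

theorem mainTheorem3 (x : ℝ) (hx₀ : 0 < x) (hx₁ : x < 1) (δ : ℝ) (hδ : 0 < δ) :
    ∃ N : ℕ, ∀ n : ℕ, N ≤ n →
      ∃ H : Hypergraph (Fin n), H.vertexSet = Set.univ ∧ H.IsLinear ∧
        (∃ q : ℕ, H.listEdgeChromaticNumber = (q : ℕ∞) ∧ x * (n : ℝ) < (q : ℝ)) ∧
        ∃ r : ℕ, H.minRank = (r : ℕ∞) ∧ H.maxRank = (r : ℕ∞) ∧
          Real.sqrt ((n : ℝ) * x) ≤ (r : ℝ) ∧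
          (r : ℝ) ≤ (1 + δ) * Real.sqrt ((n : ℝ) * x) := by
  -- `ε ≤ δ / 2` leaves room for the `+ 1` in `r = q + 1`; `ε ≤ (1 - x) / 3` gives `(1 + ε) ^ 2 ≤ 2
  -- - x`, and `x (2 - x) < 1`.
  obtain ⟨ε, hε, hεδ, hεx⟩ : ∃ ε : ℝ, 0 < ε ∧ ε ≤ δ / 2 ∧ ε ≤ (1 - x) / 3 :=
    ⟨min (δ / 2) ((1 - x) / 3), lt_min (by linarith) (by linarith), min_le_left _ _,
      min_le_right _ _⟩
  have hc : (1 + ε) ^ 2 * x < 1 := by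
    have h1 : (1 + ε) ^ 2 ≤ 1 + (1 - x) := by nlinarith
    nlinarith [mul_le_mul_of_nonneg_right h1 hx₀.le]
  set d := 1 - (1 + ε) ^ 2 * x with hd
  have hd0 : 0 < d := by linarith
  have hsqrt : Tendsto (fun n : ℕ => Real.sqrt ((n : ℝ) * x)) atTop atTop :=
    Real.tendsto_sqrt_atTop.comp (tendsto_natCast_atTop_atTop.atTop_mul_const hx₀)
  have hev := hsqrt.eventually ((eventually_exists_isPrimePow_mem_Icc hε).and
    ((eventually_ge_atTop 1).and ((eventually_ge_atTop (2 / δ)).and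
      (eventually_ge_atTop (3 / d)))))
  obtain ⟨N, hN⟩ := eventually_atTop.mp hev
  refine ⟨N, fun n hn => ?_⟩
  obtain ⟨⟨q, hq, hyq, hqy⟩, hy1, hyδ, hyd⟩ := hN n hn
  have hy2 : Real.sqrt ((n : ℝ) * x) ^ 2 = n * x := Real.sq_sqrt (by positivity)
  set y := Real.sqrt ((n : ℝ) * x)
  rw [div_le_iff₀ hδ] at hyδ
  rw [div_le_iff₀ hd0] at hyd
  have hcard : q ^ 2 + q + 1 ≤ n := by
    have h1 : (q : ℝ) ^ 2 ≤ (1 + ε) ^ 2 * x * n := by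
      calc (q : ℝ) ^ 2 ≤ ((1 + ε) * y) ^ 2 := by gcongr
        _ = (1 + ε) ^ 2 * x * n := by rw [mul_pow, hy2]; ring
    have h2 : (q : ℝ) ≤ 2 * y := hqy.trans (by nlinarith)
    -- The slack `d n` absorbs `q + 1 ≤ 3 y`; this is why `y ≥ 3 / d` is required.
    have h3 : 3 * y ≤ d * n := by
      have h4 : y ^ 2 ≤ n := by
        rw [hy2]
        exact mul_le_of_le_one_right (Nat.cast_nonneg n) hx₁.le
      calc 3 * y ≤ y * d * y := by gcongr
        _ = d * y ^ 2 := by ring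
        _ ≤ d * n := by gcongr
    have h5 : (q : ℝ) ^ 2 + q + 1 ≤ n := by
      rw [hd] at h3
      nlinarith
    exact_mod_cast h5
  obtain ⟨H, hV, hlin, hχ, hmin, hmax⟩ := Hypergraph.exists_of_isPrimePow hq hcard
  refine ⟨H, hV, hlin, ⟨_, hχ, ?_⟩, q + 1, hmin, hmax, ?_, ?_⟩
  · push_cast
    have : y ^ 2 ≤ (q : ℝ) ^ 2 := by gcongr
    rw [hy2] at this
    have hq0 : (0 : ℝ) ≤ q := Nat.cast_nonneg q
    linarith
  · push_cast
    linarith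
  · push_cast
    nlinarith
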